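/- Let $n\in\mathbb N$, let $C$ be a bivariate copula, and let $(U_1,V_1),\dots,(U_n,V_n)$ be independent random vectors, each with distribution function $C$ on $[0,1]^2$ (so that every $U_i$ and every $V_i$ is uniformly distributed on $(0,1)$). Denote by $U_{1:n}\le\dots\le U_{n:n}$ and $V_{1:n}\le\dots\le V_{n:n}$ the componentwise order statistics, and let $1\le k,m\le n$. For $y\in(0,1)$ let $U^{(1)}_1,\dots,U^{(1)}_{k-1},U^{(2)}_1,\dots,U^{(2)}_{n-k}$ be independent random variables with $$P\bigl(U^{(1)}_i\le u\bigr)=P(U_1\le u\mid V_1\le y)=\frac{C(u,y)}{y},\qquad P\bigl(U^{(2)}_i\le u\bigr)=P(U_1\le u\mid V_1>y)=\frac{u-C(u,y)}{1-y},\qquad 0\le u\le 1$$ (such random variables exist and the two conditional probabilities have the stated values), and for $x\in[0,1]$ put $$S=S_{x,y}=\sum_{i=1}^{k-1}1_{[0,x]}\bigl(U^{(1)}_i\bigr)+\sum_{i=1}^{n-k}1_{[0,x]}\bigl(U^{(2)}_i\bigr).$$ Thus $S$ is a sum of $k-1$ Bernoulli indicators with success probability $C(x,y)/y$ and $n-k$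 Bernoulli indicators with success probability $(x-C(x,y))/(1-y)$, all independent. Then for almost every $x,y\in[0,1]$ the partial derivative $\frac{\partial}{\partial y}C(x,y)$ exists and $$P(U_{m:n}\le x\mid V_{k:n}=y)=P(S\ge m)+\frac{\partial}{\partial y}C(x,y)\;P(S=m-1).$$ Here $P(U_{m:n}\le\cdot\mid V_{k:n}=y)$ is the regular conditional distribution function of $U_{m:n}$ given $V_{k:n}=y$, and "almost every $x,y$" means: for every $x\in[0,1]$ and Lebesgue-almost every $y\in[0,1]$, and also for Lebesgue-almost every $(x,y)\in[0,1]^2$. -/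

import Mathlib

open MeasureTheory ProbabilityTheory

/-- A bivariate copula: a function on the unit square that is grounded, has uniform margins and is
2-increasing. Only the values of `C` on `[0,1] × [0,1]` matter. -/
structure IsCopula (C : ℝ → ℝ → ℝ) : Prop where
  zero_left : ∀ v ∈ Set.Icc (0 : ℝ) 1, C 0 v = 0
  zero_right : ∀ u ∈ Set.Icc (0 : ℝ) 1, C u 0 = 0
  one_left : ∀ v ∈ Set.Icc (0 : ℝ) 1, C 1 v = v
  one_right : ∀ u ∈ Set.Icc (0 : ℝ) 1, C u 1 = u
  two_increasing : ∀ u₁ ∈ Set.Icc (0 : ℝ) 1, ∀ u₂ ∈ Set.Icc (0 : ℝ) 1,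
    ∀ v₁ ∈ Set.Icc (0 : ℝ) 1, ∀ v₂ ∈ Set.Icc (0 : ℝ) 1, u₁ ≤ u₂ → v₁ ≤ v₂ →
      0 ≤ C u₂ v₂ - C u₂ v₁ - C u₁ v₂ + C u₁ v₁

/-- The pair `(U, V)` has the distribution function `C` on the unit square. If `C` is a copula,
then `C 1 1 = 1` and `C u 1 = u = C 1 u`, so that `U` and `V` are both uniform on `(0,1)`. -/
def FollowsCopula {Ω : Type*} [MeasurableSpace Ω] (μ : Measure Ω) (U V : Ω → ℝ)
    (C : ℝ → ℝ → ℝ) : Prop :=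
  ∀ u ∈ Set.Icc (0 : ℝ) 1, ∀ v ∈ Set.Icc (0 : ℝ) 1, μ.real {ω | U ω ≤ u ∧ V ω ≤ v} = C u v

/-- The `j`-th order statistic `f_{j:n}`, `1 ≤ j ≤ n`, of the sample `f`: its `j`-th smallest
value, counted with multiplicity. -/
noncomputable def orderStat {n : ℕ} (f : Fin n → ℝ) (j : ℕ) (hj : 1 ≤ j ∧ j ≤ n) : ℝ :=
  f (Tuple.sort f ⟨j - 1, by omega⟩)

/-- All the random variables `W₁ i`, `i < a`, and `W₂ i`, `i < b`, together are independent, each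
`W₁ i` has distribution function `u ↦ C(u,y) / y` and each `W₂ i` has distribution function
`u ↦ (u - C(u,y)) / (1 - y)` on `[0,1]`. -/
structure IsConditionalSample {Ω : Type*} [MeasurableSpace Ω] (ν : Measure Ω) (C : ℝ → ℝ → ℝ)
    (y : ℝ) {a b : ℕ} (W₁ : Fin a → Ω → ℝ) (W₂ : Fin b → Ω → ℝ) : Prop where
  measurable_fst : ∀ i, Measurable (W₁ i)
  measurable_snd : ∀ i, Measurable (W₂ i)
  indep : iIndepFun (Sum.elim W₁ W₂) ν
  cdf_fst : ∀ i, ∀ u ∈ Set.Icc (0 : ℝ) 1, ν.real {ω | W₁ i ω ≤ u} = C u y / y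
  cdf_snd : ∀ i, ∀ u ∈ Set.Icc (0 : ℝ) 1, ν.real {ω | W₂ i ω ≤ u} = (u - C u y) / (1 - y)

/-- The number of the values `W₁ i ω` and `W₂ i ω` that lie in `[0,x]`. -/
noncomputable def countIn {Ω : Type*} {a b : ℕ} (W₁ : Fin a → Ω → ℝ) (W₂ : Fin b → Ω → ℝ)
    (x : ℝ) (ω : Ω) : ℕ :=
  (∑ i, (Set.Icc 0 x).indicator (fun _ => 1) (W₁ i ω)) +
    ∑ i, (Set.Icc 0 x).indicator (fun _ => 1) (W₂ i ω)

/-!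
Condition on which `i` has `V i = V_{k:n}`, there being almost surely no ties. Given `V i = v`, this
means that exactly `k - 1` of the other `V l` are at most `v`, and given which ones, the other `U l`
are independent with conditional laws given `V ≤ v` and `V > v`. The number of them that are at
most `x` is thus distributed as `S`, independently of `U i`. Since `U_{m:n} ≤ x` says that at least
`m` of all the `U l` are at most `x`, it happens if `S ≥ m`, or if `S = m - 1` and `U i ≤ x`; here
`U i ≤ x` has conditional probability `∂C/∂y(x, v)` given `V i = v`. Integrating over `v`, the joint
law of `V_{k:n}` and of the event `U_{m:n} ≤ x` is the asserted formula times the density of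
`V_{k:n}`.
-/

section BernoulliTrials

open scoped Classical in
/-- The probability that the number of successes among independent trials, the `i`-th of which
succeeds with probability `p i`, lies in `T`; the sum runs over the possible sets of successes. -/
noncomputable def poissonBinomial {ι : Type*} [Fintype ι] (p : ι → ℝ) (T : Set ℕ) : ℝ :=
  ∑ K : Set ι with K.ncard ∈ T, ∏ i, if i ∈ K then p i else 1 - p i

variable {ι : Type*} [Fintype ι]

theorem poissonBinomial_univ (p : ι → ℝ) : poissonBinomial p Set.univ = 1 := by
  classical
  calc poissonBinomial p Set.univ
      = ∑ K : Finset ι, ∏ i, if i ∈ K then p i else 1 - p i := by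
        simp only [poissonBinomial, Set.mem_univ, Finset.filter_true]
        exact (Fintype.sum_equiv Fintype.finsetEquivSet _ _ fun K => by simp).symm
    _ = ∏ i, (p i + (1 - p i)) := by
        rw [Fintype.prod_add]
        exact Finset.sum_congr rfl fun K _ => by
          simp only [Finset.prod_ite, Finset.filter_univ_mem, Finset.filter_notMem_eq_sdiff,
            Finset.compl_eq_univ_sdiff]
    _ = 1 := by simp

theorem poissonBinomial_nonneg {p : ι → ℝ} (hp : ∀ i, p i ∈ Set.Icc 0 1) (T : Set ℕ) :
    0 ≤ poissonBinomial p T :=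
  Finset.sum_nonneg fun K _ => Finset.prod_nonneg fun i _ => by
    split_ifs
    exacts [(hp i).1, sub_nonneg.2 (hp i).2]

theorem poissonBinomial_comp_equiv {κ : Type*} [Fintype κ] (e : ι ≃ κ) (p : κ → ℝ) (T : Set ℕ) :
    poissonBinomial (p ∘ e) T = poissonBinomial p T := by
  classical
  refine Finset.sum_equiv (Equiv.Set.congr e) (fun K => ?_) fun K _ => ?_
  · simp [Set.ncard_image_of_injective _ e.injective]
  · exact Fintype.prod_equiv e _ _ fun i => by simp

theorem measurable_poissonBinomial {β : Type*} [MeasurableSpace β] {p : β → ι → ℝ}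
    (hp : ∀ i, Measurable fun z => p z i) (T : Set ℕ) :
    Measurable fun z => poissonBinomial (p z) T :=
  Finset.measurable_sum _ fun K _ => Finset.measurable_prod _ fun i _ => by
    split_ifs
    exacts [hp i, (hp i).const_sub 1]

variable {Ω : Type*} [MeasurableSpace Ω] {ν : Measure Ω}

theorem measurable_setOf_mem {κ : Type*} {A : κ → Set Ω} (hA : ∀ i, MeasurableSet (A i)) :
    Measurable fun ω => {i | ω ∈ A i} :=
  measurable_set_iff.2 fun i => measurable_mem.2 (hA i)

theorem measurableSet_ncard_mem {κ : Type*} [Finite κ] {A : κ → Set Ω}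
    (hA : ∀ i, MeasurableSet (A i)) (T : Set ℕ) :
    MeasurableSet {ω | {i | ω ∈ A i}.ncard ∈ T} :=
  measurable_setOf_mem hA (Set.toFinite {K : Set κ | K.ncard ∈ T}).measurableSet

open scoped Classical in
theorem measureReal_inter_ncard_mem [IsFiniteMeasure ν] (S : Set Ω) {A : ι → Set Ω}
    (hA : ∀ i, MeasurableSet (A i)) (T : Set ℕ) :
    ν.real (S ∩ {ω | {i | ω ∈ A i}.ncard ∈ T}) =
      ∑ K : Set ι with K.ncard ∈ T, ν.real (S ∩ {ω | {i | ω ∈ A i} = K}) := by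
  have hmeas (s : Set (Set ι)) : MeasurableSet ((fun ω => {i | ω ∈ A i}) ⁻¹' s) :=
    measurable_setOf_mem hA s.toFinite.measurableSet
  have h := sum_measureReal_preimage_singleton (μ := ν.restrict S)
    (Finset.univ.filter fun K : Set ι => K.ncard ∈ T) fun K _ => hmeas {K}
  simp only [measureReal_restrict_apply (hmeas _), Finset.coe_filter_univ] at h
  simp only [Set.inter_comm S]
  exact h.symm

variable {β : Type*} [MeasurableSpace β] {Y : ι → Ω → β}

theorem measureReal_forall_mem_and_ncard_mem (hY : iIndepFun Y ν) (hYm : ∀ i, Measurable (Y i))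
    {E : ι → Set β} (hE : ∀ i, MeasurableSet (E i)) {A : Set β} (hA : MeasurableSet A) {p : ι → ℝ}
    (hp : ∀ i, ν.real (Y i ⁻¹' (E i ∩ A)) = ν.real (Y i ⁻¹' E i) * p i) (T : Set ℕ) :
    ν.real {ω | (∀ i, Y i ω ∈ E i) ∧ {i | Y i ω ∈ A}.ncard ∈ T} =
      (∏ i, ν.real (Y i ⁻¹' E i)) * poissonBinomial p T := by
  classical
  have := hY.isProbabilityMeasure
  have hfactor (K : Set ι) (i : ι) :
      ν.real (Y i ⁻¹' (E i ∩ if i ∈ K then A else Aᶜ)) =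
        ν.real (Y i ⁻¹' E i) * if i ∈ K then p i else 1 - p i := by
    split_ifs
    · exact hp i
    · have := measureReal_inter_add_sdiff (μ := ν) (s := Y i ⁻¹' E i) (hYm i hA)
      rw [← Set.preimage_inter, hp] at this
      rw [← Set.sdiff_eq, Set.preimage_sdiff]
      linarith
  have hK (K : Set ι) : ν.real ({ω | ∀ i, Y i ω ∈ E i} ∩ {ω | {i | Y i ω ∈ A} = K}) =
      (∏ i, ν.real (Y i ⁻¹' E i)) * ∏ i, if i ∈ K then p i else 1 - p i := by
    have hset : {ω | ∀ i, Y i ω ∈ E i} ∩ {ω | {i | Y i ω ∈ A} = K} =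
        ⋂ i ∈ Finset.univ, Y i ⁻¹' (E i ∩ if i ∈ K then A else Aᶜ) := by
      ext ω
      simp only [Set.mem_inter_iff, Set.mem_ofPred_eq, Set.ext_iff, ← forall_and, Set.mem_iInter,
        Finset.mem_univ, true_imp_iff, Set.mem_preimage]
      refine forall_congr' fun i => and_congr_right fun _ => ?_
      split_ifs with hi <;> simp [hi]
    rw [hset, measureReal_def, hY.measure_inter_preimage_eq_mul, ENNReal.toReal_prod,
      ← Finset.prod_mul_distrib]
    · exact Finset.prod_congr rfl fun i _ => hfactor K i
    · exact fun i _ => (hE i).inter (by split_ifs; exacts [hA, hA.compl])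
  rw [poissonBinomial, Finset.mul_sum]
  exact (measureReal_inter_ncard_mem _ (fun i => hYm i hA) T).trans
    (Finset.sum_congr rfl fun K _ => hK K)

theorem exists_equiv_sum_fin_mem_iff {K : Set ι} {a b : ℕ} (hK : K.ncard = a)
    (hab : Fintype.card ι = a + b) :
    ∃ e : ι ≃ Fin a ⊕ Fin b, ∀ i, i ∈ K ↔ (e i).isLeft := by
  classical
  have hKc : Kᶜ.ncard = b := by
    have := K.ncard_add_ncard_compl
    rw [Nat.card_eq_fintype_card] at this
    omega
  refine ⟨(Equiv.Set.sumCompl K).symm.trans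
    ((Finite.equivFinOfCardEq hK).sumCongr (Finite.equivFinOfCardEq hKc)), fun i => ?_⟩
  by_cases hi : i ∈ K
  · simp [Equiv.Set.sumCompl_symm_apply_of_mem hi, hi]
  · simp [Equiv.Set.sumCompl_symm_apply_of_notMem hi, hi]

theorem measureReal_setOf_eq_and_ncard_mem (hY : iIndepFun Y ν) (hYm : ∀ i, Measurable (Y i))
    {D A : Set β} (hD : MeasurableSet D) (hA : MeasurableSet A) {d p q : ℝ}
    (hd : ∀ i, ν.real (Y i ⁻¹' D) = d) (hp : ∀ i, ν.real (Y i ⁻¹' (D ∩ A)) = d * p)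
    (hq : ∀ i, ν.real (Y i ⁻¹' (Dᶜ ∩ A)) = (1 - d) * q) {a b : ℕ}
    (hab : Fintype.card ι = a + b) {K : Set ι} (hK : K.ncard = a) (T : Set ℕ) :
    ν.real ({ω | {i | Y i ω ∈ A}.ncard ∈ T} ∩ {ω | {i | Y i ω ∈ D} = K}) =
      d ^ a * (1 - d) ^ b *
        poissonBinomial (Sum.elim (fun _ : Fin a => p) (fun _ : Fin b => q)) T := by
  have := hY.isProbabilityMeasure
  obtain ⟨e, he⟩ := exists_equiv_sum_fin_mem_iff hK hab
  let E : Fin a ⊕ Fin b → Set β := Sum.elim (fun _ => D) (fun _ => Dᶜ)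
  have hset : {ω | {i | Y i ω ∈ A}.ncard ∈ T} ∩ {ω | {i | Y i ω ∈ D} = K} =
      {ω | (∀ i, Y i ω ∈ E (e i)) ∧ {i | Y i ω ∈ A}.ncard ∈ T} := by
    ext ω
    simp only [Set.mem_inter_iff, Set.mem_ofPred_eq, Set.ext_iff, he, and_comm (b := ∀ _, _)]
    refine and_congr_left fun _ => forall_congr' fun i => ?_
    rcases e i with _ | _ <;> simp [E]
  have hE (i : ι) (j : Fin a ⊕ Fin b) :
      ν.real (Y i ⁻¹' E j) = Sum.elim (fun _ => d) (fun _ => 1 - d) j := by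
    rcases j with _ | _
    · exact hd i
    · exact (probReal_compl_eq_one_sub (hYm i hD)).trans (by rw [hd]; rfl)
  have hEA (i : ι) (j : Fin a ⊕ Fin b) :
      ν.real (Y i ⁻¹' (E j ∩ A)) = ν.real (Y i ⁻¹' E j) * Sum.elim (fun _ => p) (fun _ => q) j := by
    rw [hE]
    rcases j with _ | _
    exacts [hp i, hq i]
  rw [hset, measureReal_forall_mem_and_ncard_mem hY hYm _ hA (fun i => hEA i (e i))]
  · rw [← poissonBinomial_comp_equiv e, Fintype.prod_equiv e _ _ fun i => hE i (e i)]
    simp [Function.comp_def]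
  · intro i
    rcases e i with _ | _
    exacts [hD, hD.compl]

theorem measureReal_ncard_eq_and_ncard_mem (hY : iIndepFun Y ν) (hYm : ∀ i, Measurable (Y i))
    {D A : Set β} (hD : MeasurableSet D) (hA : MeasurableSet A) {d p q : ℝ}
    (hd : ∀ i, ν.real (Y i ⁻¹' D) = d) (hp : ∀ i, ν.real (Y i ⁻¹' (D ∩ A)) = d * p)
    (hq : ∀ i, ν.real (Y i ⁻¹' (Dᶜ ∩ A)) = (1 - d) * q) {a b : ℕ}
    (hab : Fintype.card ι = a + b) (T : Set ℕ) :
    ν.real {ω | {i | Y i ω ∈ D}.ncard = a ∧ {i | Y i ω ∈ A}.ncard ∈ T} =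
      (a + b).choose a * (d ^ a * (1 - d) ^ b) *
        poissonBinomial (Sum.elim (fun _ : Fin a => p) (fun _ : Fin b => q)) T := by
  classical
  have := hY.isProbabilityMeasure
  have hcard : (Finset.univ.filter fun K : Set ι => K.ncard = a).card = (a + b).choose a := by
    rw [← hab, ← Nat.card_eq_fintype_card, ← Set.ncard_univ, ← Set.ncard_powerset_ncard
      Set.finite_univ, ← Set.ncard_coe_finset]
    simp
  calc _ = ν.real ({ω | {i | Y i ω ∈ A}.ncard ∈ T} ∩
        {ω | {i | ω ∈ Y i ⁻¹' D}.ncard ∈ ({a} : Set ℕ)}) := by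
        rw [Set.inter_comm]; rfl
    _ = ∑ K : Set ι with K.ncard = a, d ^ a * (1 - d) ^ b *
        poissonBinomial (Sum.elim (fun _ : Fin a => p) (fun _ : Fin b => q)) T := by
        rw [measureReal_inter_ncard_mem _ fun i => hYm i hD]
        exact Finset.sum_congr (by ext; simp) fun K hK => measureReal_setOf_eq_and_ncard_mem hY hYm
          hD hA hd hp hq hab (Finset.mem_filter.1 hK).2 T
    _ = _ := by rw [Finset.sum_const, hcard, nsmul_eq_mul, mul_assoc (_ : ℝ) (_ * _)]

end BernoulliTrials

section Density

open Set Filter Topology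

/-- The distribution function `v ↦ ρ (-∞, v]` of a finite measure `ρ` on the line, bundled so that
Lebesgue's differentiation theorem for Stieltjes functions applies to it. -/
noncomputable def distributionFunction (ρ : Measure ℝ) [IsFiniteMeasure ρ] :
    StieltjesFunction ℝ where
  toFun v := ρ.real (Iic v)
  mono' _ _ h := measureReal_mono (Iic_subset_Iic.2 h)
  right_continuous' v := by
    have h := tendsto_measure_biInter_gt (μ := ρ) (s := Iic) (a := v)
      (fun _ _ => measurableSet_Iic.nullMeasurableSet) (fun _ _ _ => Iic_subset_Iic.2)
      ⟨v + 1, by simp, measure_ne_top _ _⟩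
    have hIic : ⋂ r > v, Iic r = Iic v := by
      ext w
      simpa only [mem_iInter, mem_Iic] using forall_gt_imp_ge_iff_le_of_dense
    rw [hIic] at h
    exact continuousWithinAt_Ioi_iff_Ici.1
      ((ENNReal.tendsto_toReal (measure_ne_top ρ (Iic v))).comp h)

variable {ρ : Measure ℝ} [IsFiniteMeasure ρ] {s : Set ℝ} {g : ℝ → ℝ}

theorem measure_distributionFunction : (distributionFunction ρ).measure = ρ := by
  refine Measure.ext_of_Ioc _ _ fun a b hab => ?_
  rw [StieltjesFunction.measure_Ioc, ← Iic_sdiff_Iic,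
    measure_sdiff (Iic_subset_Iic.2 hab.le) measurableSet_Iic.nullMeasurableSet
      (measure_ne_top _ _)]
  exact (ENNReal.ofReal_sub _ measureReal_nonneg).trans
    (congr_arg₂ _ ofReal_measureReal ofReal_measureReal)

theorem ae_hasDerivAt_of_forall_real_Iic_eq (hs : IsOpen s)
    (hg : ∀ v ∈ s, ρ.real (Iic v) = g v) :
    ∀ᵐ v ∂(volume.restrict s), HasDerivAt g (ρ.rnDeriv volume v).toReal v := by
  have h := (distributionFunction ρ).ae_hasDerivAt
  rw [measure_distributionFunction] at h
  filter_upwards [ae_restrict_of_ae h, ae_restrict_mem hs.measurableSet] with v hv hvs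
  exact hv.congr_of_eventuallyEq (by
    filter_upwards [hs.mem_nhds hvs] with w hw using (hg w hw).symm)

theorem eq_withDensity_deriv_of_forall_real_Iic_eq (hs : IsOpen s) (hρ : ρ ≪ volume.restrict s)
    (hg : ∀ v ∈ s, ρ.real (Iic v) = g v) :
    ρ = (volume.restrict s).withDensity fun v => ENNReal.ofReal (deriv g v) := by
  have hs' : ρ.restrict s = ρ := Measure.restrict_eq_self_of_ae_mem
    (hρ.ae_le (ae_restrict_mem hs.measurableSet))
  calc ρ = (volume.withDensity (ρ.rnDeriv volume)).restrict s := by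
        rw [Measure.withDensity_rnDeriv_eq _ _
          (hρ.trans Measure.restrict_le_self.absolutelyContinuous), hs']
    _ = (volume.restrict s).withDensity (ρ.rnDeriv volume) :=
        restrict_withDensity hs.measurableSet _
    _ = _ := withDensity_congr_ae (by
        filter_upwards [ae_hasDerivAt_of_forall_real_Iic_eq hs hg,
          ae_restrict_of_ae (ρ.rnDeriv_lt_top volume)] with v hv hfin
        rw [hv.deriv, ENNReal.ofReal_toReal hfin.ne])

end Density

section Copula

open Set

variable {C : ℝ → ℝ → ℝ}

namespace IsCopula

theorem mono_right (hC : IsCopula C) {u v₁ v₂ : ℝ} (hu : u ∈ Icc (0 : ℝ) 1)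
    (h₁ : v₁ ∈ Icc (0 : ℝ) 1) (h₂ : v₂ ∈ Icc (0 : ℝ) 1) (h : v₁ ≤ v₂) : C u v₁ ≤ C u v₂ := by
  have := hC.two_increasing 0 (by simp) u hu v₁ h₁ v₂ h₂ hu.1 h
  rw [hC.zero_left _ h₁, hC.zero_left _ h₂] at this
  linarith

theorem sub_le_right (hC : IsCopula C) {u v₁ v₂ : ℝ} (hu : u ∈ Icc (0 : ℝ) 1)
    (h₁ : v₁ ∈ Icc (0 : ℝ) 1) (h₂ : v₂ ∈ Icc (0 : ℝ) 1) (h : v₁ ≤ v₂) :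
    C u v₂ - C u v₁ ≤ v₂ - v₁ := by
  have := hC.two_increasing u hu 1 (by simp) v₁ h₁ v₂ h₂ hu.2 h
  rw [hC.one_left _ h₁, hC.one_left _ h₂] at this
  linarith

theorem swap (hC : IsCopula C) : IsCopula (fun u v => C v u) where
  zero_left := hC.zero_right
  zero_right := hC.zero_left
  one_left := hC.one_right
  one_right := hC.one_left
  two_increasing u₁ hu₁ u₂ hu₂ v₁ hv₁ v₂ hv₂ hu hv := by
    have := hC.two_increasing v₁ hv₁ v₂ hv₂ u₁ hu₁ u₂ hu₂ hv hu
    linarith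

theorem lipschitzOnWith_right (hC : IsCopula C) {u : ℝ} (hu : u ∈ Icc (0 : ℝ) 1) :
    LipschitzOnWith 1 (C u) (Icc 0 1) :=
  LipschitzOnWith.of_le_add fun a ha b hb => by
    rcases le_total a b with h | h
    · linarith [hC.mono_right hu ha hb h, dist_nonneg (x := a) (y := b)]
    · linarith [hC.sub_le_right hu hb ha h, le_abs_self (a - b), Real.dist_eq a b]

theorem continuousOn_uncurry (hC : IsCopula C) :
    ContinuousOn (Function.uncurry C) (Icc 0 1 ×ˢ Icc 0 1) :=
  continuousOn_prod_of_continuousOn_lipschitzOnWith _ 1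
    (fun _ hu => (hC.lipschitzOnWith_right hu).continuousOn)
    (fun _ hv => hC.swap.lipschitzOnWith_right hv)

theorem deriv_nonneg (hC : IsCopula C) {u v : ℝ} (hu : u ∈ Icc (0 : ℝ) 1)
    (hv : v ∈ Ioo (0 : ℝ) 1) : 0 ≤ deriv (C u) v := by
  have hmono : MonotoneOn (C u) (Icc 0 1) := fun a ha b hb hab => hC.mono_right hu ha hb hab
  rw [← derivWithin_of_mem_nhds (Icc_mem_nhds hv.1 hv.2)]
  exact hmono.derivWithin_nonneg

end IsCopula

namespace FollowsCopula

variable {Ω : Type*} [MeasurableSpace Ω] {μ : Measure Ω} {U V : Ω → ℝ}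

theorem swap (h : FollowsCopula μ U V C) : FollowsCopula μ V U (fun u v => C v u) :=
  fun u hu v hv => by simpa only [and_comm] using h v hv u hu

theorem real_Iic_map_snd_restrict_fst_le [IsFiniteMeasure μ] (h : FollowsCopula μ U V C)
    (hV : Measurable V) {x v : ℝ}
    (hx : x ∈ Icc (0 : ℝ) 1) (hv : v ∈ Icc (0 : ℝ) 1) :
    ((μ.restrict {ω | U ω ≤ x}).map V).real (Iic v) = C x v := by
  rw [map_measureReal_apply hV measurableSet_Iic, measureReal_restrict_apply (hV measurableSet_Iic),
    ← h x hx v hv, inter_comm]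
  rfl

theorem ae_differentiableAt [IsFiniteMeasure μ] (h : FollowsCopula μ U V C)
    (hV : Measurable V) {x : ℝ}
    (hx : x ∈ Icc (0 : ℝ) 1) :
    ∀ᵐ v ∂(volume.restrict (Ioo 0 1)), DifferentiableAt ℝ (C x) v :=
  (ae_hasDerivAt_of_forall_real_Iic_eq isOpen_Ioo fun _ hv =>
    h.real_Iic_map_snd_restrict_fst_le hV hx (Ioo_subset_Icc_self hv)).mono
    fun _ hv => hv.differentiableAt

variable [IsProbabilityMeasure μ]

theorem ae_le_one (hC : IsCopula C) (h : FollowsCopula μ U V C) (hU : Measurable U)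
    (hV : Measurable V) : ∀ᵐ ω ∂μ, U ω ≤ 1 ∧ V ω ≤ 1 := by
  have h1 : μ.real {ω | U ω ≤ 1 ∧ V ω ≤ 1} = 1 :=
    (h 1 (by simp) 1 (by simp)).trans (hC.one_left 1 (by simp))
  rw [measureReal_def, ENNReal.toReal_eq_one_iff] at h1
  exact (prob_compl_eq_zero_iff ((measurableSet_le hU measurable_const).inter
    (measurableSet_le hV measurable_const))).2 h1

theorem real_fst_le (hC : IsCopula C) (h : FollowsCopula μ U V C) (hU : Measurable U)
    (hV : Measurable V) {u : ℝ} (hu : u ∈ Icc (0 : ℝ) 1) : μ.real {ω | U ω ≤ u} = u := by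
  refine Eq.trans ?_ ((h u hu 1 (by simp)).trans (hC.one_right u hu))
  refine measureReal_congr (Filter.eventuallyEq_set.2 ?_)
  filter_upwards [h.ae_le_one hC hU hV] with ω hω
  simp [hω.2]

theorem real_snd_le (hC : IsCopula C) (h : FollowsCopula μ U V C) (hU : Measurable U)
    (hV : Measurable V) {v : ℝ} (hv : v ∈ Icc (0 : ℝ) 1) : μ.real {ω | V ω ≤ v} = v :=
  h.swap.real_fst_le hC.swap hV hU hv

theorem real_snd_gt (hC : IsCopula C) (h : FollowsCopula μ U V C) (hU : Measurable U)
    (hV : Measurable V) {v : ℝ} (hv : v ∈ Icc (0 : ℝ) 1) : μ.real {ω | v < V ω} = 1 - v := by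
  have := probReal_compl_eq_one_sub (μ := μ) (measurableSet_le hV (measurable_const (a := v)))
  simpa only [h.real_snd_le hC hU hV hv, compl_ofPred, not_le] using this

theorem real_fst_le_inter_snd_gt (hC : IsCopula C) (h : FollowsCopula μ U V C) (hU : Measurable U)
    (hV : Measurable V) {u v : ℝ} (hu : u ∈ Icc (0 : ℝ) 1) (hv : v ∈ Icc (0 : ℝ) 1) :
    μ.real {ω | U ω ≤ u ∧ v < V ω} = u - C u v := by
  have h1 := measureReal_inter_add_sdiff (μ := μ) (s := {ω | U ω ≤ u})
    (measurableSet_le hV (measurable_const (a := v)))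
  have h2 : {ω | U ω ≤ u ∧ v < V ω} = {ω | U ω ≤ u} \ {ω | V ω ≤ v} := by ext; simp
  rw [← ofPred_and, h u hu v hv, h.real_fst_le hC hU hV hu, ← h2] at h1
  linarith

theorem map_snd (hC : IsCopula C) (h : FollowsCopula μ U V C) (hU : Measurable U)
    (hV : Measurable V) : μ.map V = volume.restrict (Ioo 0 1) := by
  have hpos : ∀ᵐ ω ∂μ, 0 < V ω := by
    have h0 := h.real_snd_le hC hU hV (v := 0) (by simp)
    rw [measureReal_eq_zero_iff] at h0
    simpa only [mem_ofPred_eq, not_le] using measure_eq_zero_iff_ae_notMem.1 h0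
  refine Measure.ext_of_Iic _ _ fun v => ?_
  have hv : max 0 (min 1 v) ∈ Icc (0 : ℝ) 1 := by simp
  calc μ.map V (Iic v) = μ {ω | V ω ≤ max 0 (min 1 v)} := by
        rw [Measure.map_apply hV measurableSet_Iic]
        refine measure_congr (Filter.eventuallyEq_set.2 ?_)
        filter_upwards [hpos, h.ae_le_one hC hU hV] with ω hω0 hω1
        simp [hω0, hω1.2]
    _ = ENNReal.ofReal (min 1 v) := by
        rw [← ofReal_measureReal, h.real_snd_le hC hU hV hv, ENNReal.ofReal_max,
          ENNReal.ofReal_zero, max_eq_right zero_le]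
    _ = volume.restrict (Ioo 0 1) (Iic v) := by
        rw [Measure.restrict_congr_set Ioo_ae_eq_Ioc, Measure.restrict_apply measurableSet_Iic,
          inter_comm, Ioc_inter_Iic, Real.volume_Ioc, sub_zero]

theorem absolutelyContinuous_map_snd_restrict (hC : IsCopula C) (h : FollowsCopula μ U V C)
    (hU : Measurable U) (hV : Measurable V) (s : Set Ω) :
    (μ.restrict s).map V ≪ volume.restrict (Ioo 0 1) := by
  rw [← h.map_snd hC hU hV]
  exact Measure.restrict_le_self.absolutelyContinuous.map hV

theorem map_snd_restrict_fst_le (hC : IsCopula C) (h : FollowsCopula μ U V C) (hU : Measurable U)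
    (hV : Measurable V) {x : ℝ} (hx : x ∈ Icc (0 : ℝ) 1) :
    (μ.restrict {ω | U ω ≤ x}).map V =
      (volume.restrict (Ioo 0 1)).withDensity fun v => ENNReal.ofReal (deriv (C x) v) :=
  eq_withDensity_deriv_of_forall_real_Iic_eq isOpen_Ioo
    (h.absolutelyContinuous_map_snd_restrict hC hU hV _)
    fun _ hv => h.real_Iic_map_snd_restrict_fst_le hV hx (Ioo_subset_Icc_self hv)

theorem cond_real_fst_le (hC : IsCopula C) (h : FollowsCopula μ U V C)
    (hU : Measurable U) (hV : Measurable V) {u y : ℝ} (hu : u ∈ Icc (0 : ℝ) 1)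
    (hy : y ∈ Icc (0 : ℝ) 1) :
    (cond μ {ω | V ω ≤ y}).real {ω | U ω ≤ u} = C u y / y ∧
      (cond μ {ω | y < V ω}).real {ω | U ω ≤ u} = (u - C u y) / (1 - y) := by
  constructor
  · rw [measureReal_def, cond_apply (measurableSet_le hV measurable_const), ENNReal.toReal_mul,
      ENNReal.toReal_inv, ← measureReal_def, ← measureReal_def, h.real_snd_le hC hU hV hy,
      ← h u hu y hy, div_eq_inv_mul, inter_comm]
    rfl
  · rw [measureReal_def, cond_apply (measurableSet_lt measurable_const hV), ENNReal.toReal_mul,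
      ENNReal.toReal_inv, ← measureReal_def, ← measureReal_def, h.real_snd_gt hC hU hV hy,
      ← h.real_fst_le_inter_snd_gt hC hU hV hu hy, div_eq_inv_mul, inter_comm]
    rfl

end FollowsCopula

end Copula

section ClampSquare

open Set

variable {C : ℝ → ℝ → ℝ} {x y : ℝ}

/-- The extension of a function on the unit square to the plane through the nearest point of the
square. It makes a copula continuous, and so measurable, outside of the square too. -/
noncomputable def clampSquare (C : ℝ → ℝ → ℝ) (x y : ℝ) : ℝ :=
  C (projIcc 0 1 zero_le_one x) (projIcc 0 1 zero_le_one y)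

theorem clampSquare_of_mem (hx : x ∈ Icc (0 : ℝ) 1) (hy : y ∈ Icc (0 : ℝ) 1) :
    clampSquare C x y = C x y := by
  rw [clampSquare, projIcc_of_mem _ hx, projIcc_of_mem _ hy]

theorem clampSquare_eventuallyEq (hx : x ∈ Icc (0 : ℝ) 1) (hy : y ∈ Ioo (0 : ℝ) 1) :
    clampSquare C x =ᶠ[nhds y] C x := by
  filter_upwards [Icc_mem_nhds hy.1 hy.2] with v hv using clampSquare_of_mem hx hv

theorem IsCopula.continuous_clampSquare (hC : IsCopula C) :
    Continuous (Function.uncurry (clampSquare C)) :=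
  hC.continuousOn_uncurry.comp_continuous
    (f := fun p : ℝ × ℝ => ((projIcc 0 1 zero_le_one p.1 : ℝ), (projIcc 0 1 zero_le_one p.2 : ℝ)))
    (by fun_prop) fun _ => ⟨Subtype.coe_prop _, Subtype.coe_prop _⟩

end ClampSquare

section Independence

open Set

variable {Ω β : Type*} [MeasurableSpace Ω] [MeasurableSpace β] {μ : Measure Ω}

theorem indepFun_subtype_ne {ι : Type*} [Finite ι] {Y : ι → Ω → β} (h : iIndepFun Y μ)
    (hY : ∀ i, Measurable (Y i)) (i : ι) :
    IndepFun (Y i) (fun ω (l : {l // l ≠ i}) => Y l ω) μ := by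
  classical
  cases nonempty_fintype ι
  exact (h.indepFun_finset {i} {i}ᶜ disjoint_compl_right hY).comp
    (φ := fun y : ({i} : Finset ι) → β => y ⟨i, by simp⟩)
    (ψ := fun (y : ({i}ᶜ : Finset ι) → β) (l : {l // l ≠ i}) => y ⟨l, by simpa using l.2⟩)
    (by fun_prop) (by fun_prop)

variable [IsFiniteMeasure μ]

theorem measure_mem_and_prodMk_mem_eq_lintegral {α γ : Type*} [MeasurableSpace α]
    [MeasurableSpace γ] {X : Ω → α} {Z : Ω → γ} {Y : Ω → β}
    (h : IndepFun (fun ω => (X ω, Z ω)) Y μ) (hZ : Measurable Z) (hY : Measurable Y)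
    {A : Set α} (hA : MeasurableSet A) {S : Set (γ × β)}
    (hS : MeasurableSet S) :
    μ {ω | X ω ∈ A ∧ (Z ω, Y ω) ∈ S} =
      ∫⁻ z, μ {ω | (z, Y ω) ∈ S} ∂((μ.restrict (X ⁻¹' A)).map Z) := by
  have hprod : ((μ.restrict (X ⁻¹' A)).map Z).prod (μ.map Y) =
      (μ.restrict (X ⁻¹' A)).map fun ω => (Z ω, Y ω) := by
    refine Measure.prod_eq fun s t hs ht => ?_
    have hst := h.measure_inter_preimage_eq_mul _ _ (hA.prod hs) ht
    rw [Measure.map_apply (hZ.prodMk hY) (hs.prod ht), Measure.map_apply hZ hs,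
      Measure.map_apply hY ht, Measure.restrict_apply (hZ hs),
      Measure.restrict_apply ((hZ.prodMk hY) (hs.prod ht)), inter_comm, inter_comm (Z ⁻¹' s),
      mk_preimage_prod, ← inter_assoc]
    simpa only [mk_preimage_prod] using hst
  calc μ {ω | X ω ∈ A ∧ (Z ω, Y ω) ∈ S}
      = (μ.restrict (X ⁻¹' A)).map (fun ω => (Z ω, Y ω)) S := by
        rw [Measure.map_apply (hZ.prodMk hY) hS, Measure.restrict_apply ((hZ.prodMk hY) hS),
          inter_comm]
        rfl
    _ = ∫⁻ z, μ {ω | (z, Y ω) ∈ S} ∂((μ.restrict (X ⁻¹' A)).map Z) := by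
        rw [← hprod, Measure.prod_apply hS]
        exact lintegral_congr fun z => Measure.map_apply hY (measurable_prodMk_left hS)

theorem ae_ne_of_indepFun {X Y : Ω → ℝ} (h : IndepFun X Y μ) (hX : Measurable X)
    (hY : Measurable Y) [NullSingletonClass (μ.map Y)] : ∀ᵐ ω ∂μ, X ω ≠ Y ω := by
  have hdiag : MeasurableSet {p : ℝ × ℝ | p.1 = p.2} :=
    measurableSet_eq_fun measurable_fst measurable_snd
  have hnull : (μ.map X).prod (μ.map Y) {p : ℝ × ℝ | p.1 = p.2} = 0 :=
    (Measure.measure_prod_null hdiag).2 (.of_forall fun x =>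
      (congr_arg _ (by ext; simp [eq_comm])).trans (measure_singleton x))
  rw [← h.map_prod_eq_prod_map_map hX.aemeasurable hY.aemeasurable,
    Measure.map_apply (hX.prodMk hY) hdiag] at hnull
  exact measure_eq_zero_iff_ae_notMem.1 hnull

theorem ae_injective_of_iIndepFun {ι : Type*} [Countable ι] {Y : ι → Ω → ℝ} (h : iIndepFun Y μ)
    (hY : ∀ i, Measurable (Y i)) [∀ i, NullSingletonClass (μ.map (Y i))] :
    ∀ᵐ ω ∂μ, Function.Injective fun i => Y i ω := by
  have hne : ∀ᵐ ω ∂μ, ∀ i j, i ≠ j → Y i ω ≠ Y j ω :=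
    ae_all_iff.2 fun i => ae_all_iff.2 fun j => Filter.eventually_imp_distrib_left.2 fun hij =>
      ae_ne_of_indepFun (h.indepFun hij) (hY i) (hY j)
  filter_upwards [hne] with ω hω i j hij
  exact not_imp_not.1 (hω i j) hij

end Independence

section OrderStatistics

open Set

theorem ncard_setOf_eq_ncard_subtype_ne_add {ι : Type*} [Finite ι] (P : ι → Prop)
    [DecidablePred P] (i : ι) :
    {l | P l}.ncard = {l : {l // l ≠ i} | P l}.ncard + if P i then 1 else 0 := by
  have himage : {l | P l} \ {i} = Subtype.val '' {l : {l // l ≠ i} | P l} := by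
    ext l
    simp [and_comm]
  rw [← ncard_image_of_injective _ Subtype.val_injective, ← himage]
  split_ifs with hi
  · exact (ncard_sdiff_singleton_add_one hi).symm
  · rw [sdiff_singleton_eq_self (s := {l | P l}) hi, add_zero]

variable {n : ℕ}

theorem ncard_setOf_comp_sort (f : Fin n → ℝ) (P : ℝ → Prop) :
    {i | P (f (Tuple.sort f i))}.ncard = {i | P (f i)}.ncard := by
  rw [← ncard_image_of_injective _ (Tuple.sort f).injective,
    ← Equiv.setOfPred_apply_symm_eq_image_setOfPred]
  simp

theorem orderStat_le_iff (f : Fin n → ℝ) {j : ℕ} (hj : 1 ≤ j ∧ j ≤ n) (x : ℝ) :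
    orderStat f j hj ≤ x ↔ j ≤ {i | f i ≤ x}.ncard := by
  have h := Tuple.lt_card_le_iff_apply_le_of_monotone (j := (⟨j - 1, by omega⟩ : Fin n))
    (a := x) (Tuple.monotone_sort f)
  rw [← Set.ncard_coe_finset, Finset.coe_filter_univ] at h
  rw [← ncard_setOf_comp_sort f (· ≤ x), orderStat]
  refine h.symm.trans ?_
  simp only [Function.comp_apply]
  omega

theorem measurable_orderStat {Ω : Type*} [MeasurableSpace Ω] {f : Fin n → Ω → ℝ}
    (hf : ∀ i, Measurable (f i)) {j : ℕ} (hj : 1 ≤ j ∧ j ≤ n) :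
    Measurable (fun ω => orderStat (fun i => f i ω) j hj) := by
  refine measurable_of_Iic fun x => ?_
  simp only [preimage, mem_Iic, orderStat_le_iff]
  exact measurableSet_ncard_mem
    (fun i => measurableSet_le (hf i) (measurable_const (a := x))) (Ici j)

theorem orderStat_eq_iff {f : Fin n → ℝ} (hf : Function.Injective f) {j : ℕ}
    (hj : 1 ≤ j ∧ j ≤ n) (i : Fin n) :
    orderStat f j hj = f i ↔ {l : {l // l ≠ i} | f l ≤ f i}.ncard = j - 1 := by
  classical
  have hmono : StrictMono (f ∘ Tuple.sort f) :=
    (Tuple.monotone_sort f).strictMono_of_injective (hf.comp (Tuple.sort f).injective)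
  have hrank (r : Fin n) : {l | f l ≤ f (Tuple.sort f r)}.ncard = r + 1 := by
    rw [← ncard_setOf_comp_sort f (· ≤ _), ← Fin.card_Iic, ← ncard_coe_finset, Finset.coe_Iic]
    exact congr_arg _ (ext fun l => hmono.le_iff_le)
  obtain ⟨r, rfl⟩ := (Tuple.sort f).surjective i
  have h := ncard_setOf_eq_ncard_subtype_ne_add (f · ≤ f (Tuple.sort f r)) (Tuple.sort f r)
  rw [hrank, if_pos le_rfl, Nat.add_right_cancel_iff] at h
  rw [← h, orderStat, hf.eq_iff, (Tuple.sort f).injective.eq_iff, Fin.ext_iff, eq_comm]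

variable {Ω : Type*} [MeasurableSpace Ω] {μ : Measure Ω} {V : Fin n → Ω → ℝ}

theorem measurableSet_mem_and_ncard_eq (hV : ∀ i, Measurable (V i)) (i : Fin n) {B : Set ℝ}
    (hB : MeasurableSet B) (a : ℕ) :
    MeasurableSet {ω | V i ω ∈ B ∧ {l : {l // l ≠ i} | V l ω ≤ V i ω}.ncard = a} :=
  (hV i hB).inter
    (measurableSet_ncard_mem (fun l : {l // l ≠ i} => measurableSet_le (hV l) (hV i)) {a})

theorem measure_orderStat_mem_inter_eq_sum (hV : ∀ i, Measurable (V i))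
    (hinj : ∀ᵐ ω ∂μ, Function.Injective fun i => V i ω) {j : ℕ} (hj : 1 ≤ j ∧ j ≤ n) {B : Set ℝ}
    (hB : MeasurableSet B) {E : Set Ω} (hE : MeasurableSet E) :
    μ ({ω | orderStat (fun i => V i ω) j hj ∈ B} ∩ E) =
      ∑ i, μ ({ω | V i ω ∈ B ∧ {l : {l // l ≠ i} | V l ω ≤ V i ω}.ncard = j - 1} ∩ E) := by
  set D := fun i => {ω | V i ω ∈ B ∧ {l : {l // l ≠ i} | V l ω ≤ V i ω}.ncard = j - 1} with hD
  have hunion :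
      ({ω | orderStat (fun i => V i ω) j hj ∈ B} ∩ E : Set Ω) =ᵐ[μ] (⋃ i, D i ∩ E : Set Ω) := by
    refine Filter.eventuallyEq_set.2 ?_
    filter_upwards [hinj] with ω hω
    simp only [hD, ← orderStat_eq_iff hω hj, ← iUnion_inter, mem_inter_iff, mem_iUnion,
      mem_ofPred_eq]
    refine and_congr_left fun _ => ⟨fun h => ⟨_, h, rfl⟩, ?_⟩
    rintro ⟨i, hi, h⟩
    rwa [h]
  rw [measure_congr hunion, measure_iUnion₀, tsum_fintype]
  · intro i i' hii'
    refine measure_mono_null ?_ hinj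
    rintro ω ⟨⟨hi, -⟩, ⟨hi', -⟩⟩ hω
    exact hii' (hω (((orderStat_eq_iff hω hj i).2 hi.2).symm.trans
      ((orderStat_eq_iff hω hj i').2 hi'.2)))
  · exact fun i => ((measurableSet_mem_and_ncard_eq hV i hB _).inter hE).nullMeasurableSet

end OrderStatistics

section JointLaw

open Set

/-- The success probabilities `C(x,y) / y` of the first `a` and `(x - C(x,y)) / (1 - y)` of the last
`b` of the independent trials whose number of successes is the variable `S` of the paper. -/
noncomputable def successProb (C : ℝ → ℝ → ℝ) (a b : ℕ) (x y : ℝ) : Fin a ⊕ Fin b → ℝ :=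
  Sum.elim (fun _ => C x y / y) (fun _ => (x - C x y) / (1 - y))

/-- The probability that exactly `a` of `a + b` independent uniform variables on `(0,1)` are at
most `v`. -/
noncomputable def binomialProb (a b : ℕ) (v : ℝ) : ℝ :=
  (a + b).choose a * (v ^ a * (1 - v) ^ b)

/-- The right-hand side `P(S ≥ m) + ∂C/∂y(x,y) P(S = m - 1)` of the formula for the conditional
distribution function of `U_{m:n}` given `V_{k:n} = y`, with `a = k - 1` and `b = n - k`. -/
noncomputable def orderStatCondCDF (C : ℝ → ℝ → ℝ) (a b m : ℕ) (x y : ℝ) : ℝ :=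
  poissonBinomial (successProb C a b x y) (Ici m) +
    deriv (C x) y * poissonBinomial (successProb C a b x y) {m - 1}

theorem binomialProb_pos (a b : ℕ) {v : ℝ} (hv : v ∈ Ioo (0 : ℝ) 1) : 0 < binomialProb a b v := by
  have h0 := hv.1
  have h1 : 0 < 1 - v := sub_pos.2 hv.2
  have hchoose : 0 < (a + b).choose a := Nat.choose_pos (by omega)
  unfold binomialProb
  positivity

theorem measurable_binomialProb (a b : ℕ) : Measurable (binomialProb a b) := by
  unfold binomialProb
  fun_prop

variable {C : ℝ → ℝ → ℝ}

theorem IsCopula.successProb_mem_Icc (hC : IsCopula C) {x y : ℝ} (hx : x ∈ Icc (0 : ℝ) 1)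
    (hy : y ∈ Ioo (0 : ℝ) 1) {a b : ℕ} (i : Fin a ⊕ Fin b) :
    successProb C a b x y i ∈ Icc 0 1 := by
  have hyI := Ioo_subset_Icc_self hy
  have hy1 : 0 < 1 - y := sub_pos.2 hy.2
  have hmono₀ := hC.mono_right hx (by simp) hyI hyI.1
  have hmono₁ := hC.mono_right hx hyI (by simp) hyI.2
  have hlip₀ := hC.sub_le_right hx (by simp) hyI hyI.1
  have hlip₁ := hC.sub_le_right hx hyI (by simp) hyI.2
  rw [hC.zero_right x hx] at hmono₀ hlip₀
  rw [hC.one_right x hx] at hmono₁ hlip₁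
  rcases i with _ | _
  · exact ⟨div_nonneg hmono₀ hy.1.le, (div_le_one hy.1).2 (by linarith)⟩
  · exact ⟨div_nonneg (by linarith) hy1.le, (div_le_one hy1).2 hlip₁⟩

theorem IsCopula.orderStatCondCDF_nonneg (hC : IsCopula C) {x y : ℝ} (hx : x ∈ Icc (0 : ℝ) 1)
    (hy : y ∈ Ioo (0 : ℝ) 1) (a b m : ℕ) : 0 ≤ orderStatCondCDF C a b m x y :=
  add_nonneg (poissonBinomial_nonneg (hC.successProb_mem_Icc hx hy) _)
    (mul_nonneg (hC.deriv_nonneg hx hy) (poissonBinomial_nonneg (hC.successProb_mem_Icc hx hy) _))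

theorem IsCopula.ofReal_binomialProb_mul_orderStatCondCDF (hC : IsCopula C) {x v : ℝ}
    (hx : x ∈ Icc (0 : ℝ) 1) (hv : v ∈ Ioo (0 : ℝ) 1) (a b m : ℕ) :
    ENNReal.ofReal (binomialProb a b v * orderStatCondCDF C a b m x v) =
      ENNReal.ofReal (binomialProb a b v * poissonBinomial (successProb C a b x v) (Ici m)) +
        ENNReal.ofReal (binomialProb a b v *
          (deriv (C x) v * poissonBinomial (successProb C a b x v) {m - 1})) := by
  have hbinom := (binomialProb_pos a b hv).le
  have hpb := poissonBinomial_nonneg (hC.successProb_mem_Icc (a := a) (b := b) hx hv)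
  rw [← ENNReal.ofReal_add (mul_nonneg hbinom (hpb _))
    (mul_nonneg hbinom (mul_nonneg (hC.deriv_nonneg hx hv) (hpb _))), ← mul_add, orderStatCondCDF]

theorem measurable_poissonBinomial_successProb {β : Type*} [MeasurableSpace β] {f g : β → ℝ}
    (hf : Measurable f) (hg : Measurable g) (hC : Measurable fun z => C (f z) (g z)) (a b : ℕ)
    (T : Set ℕ) : Measurable fun z => poissonBinomial (successProb C a b (f z) (g z)) T := by
  refine measurable_poissonBinomial (fun i => ?_) T
  rcases i with _ | _
  · exact hC.div hg
  · exact (hf.sub hC).div (hg.const_sub 1)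

theorem IsCopula.aemeasurable_poissonBinomial_successProb (hC : IsCopula C) {x : ℝ}
    (hx : x ∈ Icc (0 : ℝ) 1) (a b : ℕ) (T : Set ℕ) :
    AEMeasurable (fun v => poissonBinomial (successProb C a b x v) T)
      (volume.restrict (Ioo 0 1)) := by
  refine ⟨_, measurable_poissonBinomial_successProb measurable_const measurable_id
    (hC.continuous_clampSquare.comp (Continuous.prodMk_right x)).measurable a b T, ?_⟩
  filter_upwards [ae_restrict_mem measurableSet_Ioo] with v hv
  simp only [successProb, id, clampSquare_of_mem hx (Ioo_subset_Icc_self hv)]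

theorem IsCopula.aemeasurable_orderStatCondCDF (hC : IsCopula C) {x : ℝ}
    (hx : x ∈ Icc (0 : ℝ) 1) (a b m : ℕ) :
    AEMeasurable (orderStatCondCDF C a b m x) (volume.restrict (Ioo 0 1)) :=
  (hC.aemeasurable_poissonBinomial_successProb hx a b _).add
    ((measurable_deriv (C x)).aemeasurable.mul
      (hC.aemeasurable_poissonBinomial_successProb hx a b _))

variable {Ω ι : Type*} [MeasurableSpace Ω] {μ : Measure Ω} [Fintype ι] {U V : ι → Ω → ℝ}

theorem measureReal_ncard_snd_le_eq_and_ncard_fst_le_mem (hC : IsCopula C)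
    (hU : ∀ i, Measurable (U i)) (hV : ∀ i, Measurable (V i))
    (hindep : iIndepFun (fun i ω => (U i ω, V i ω)) μ)
    (hlaw : ∀ i, FollowsCopula μ (U i) (V i) C) {x v : ℝ} (hx : x ∈ Icc (0 : ℝ) 1)
    (hv : v ∈ Ioo (0 : ℝ) 1) {a b : ℕ} (hab : Fintype.card ι = a + b) (T : Set ℕ) :
    μ.real {ω | {i | V i ω ≤ v}.ncard = a ∧ {i | U i ω ≤ x}.ncard ∈ T} =
      binomialProb a b v * poissonBinomial (successProb C a b x v) T := by
  have := hindep.isProbabilityMeasure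
  have hvI := Ioo_subset_Icc_self hv
  refine measureReal_ncard_eq_and_ncard_mem (D := {z : ℝ × ℝ | z.2 ≤ v}) (A := {z | z.1 ≤ x})
    (d := v) (p := C x v / v) (q := (x - C x v) / (1 - v)) hindep
    (fun i => (hU i).prodMk (hV i)) (measurableSet_le measurable_snd measurable_const)
    (measurableSet_le measurable_fst measurable_const)
    (fun i => (hlaw i).real_snd_le hC (hU i) (hV i) hvI) (fun i => ?_) (fun i => ?_) hab T
  · rw [mul_div_cancel₀ _ hv.1.ne', ← hlaw i x hx v hvI, inter_comm]
    rfl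
  · rw [mul_div_cancel₀ _ (sub_pos.2 hv.2).ne',
      ← (hlaw i).real_fst_le_inter_snd_gt hC (hU i) (hV i) hx hvI, inter_comm]
    simp only [preimage_inter, compl_ofPred, not_le]
    rfl

theorem measure_fst_mem_and_snd_mem_and_ncard (hC : IsCopula C)
    (hU : ∀ i, Measurable (U i)) (hV : ∀ i, Measurable (V i))
    (hindep : iIndepFun (fun i ω => (U i ω, V i ω)) μ)
    (hlaw : ∀ i, FollowsCopula μ (U i) (V i) C) {x : ℝ} (hx : x ∈ Icc (0 : ℝ) 1) {a b : ℕ}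
    (hab : Fintype.card ι = a + b + 1) (i : ι) {A B : Set ℝ} (hA : MeasurableSet A)
    (hB : MeasurableSet B) (T : Set ℕ) :
    μ {ω | U i ω ∈ A ∧ V i ω ∈ B ∧ {l : {l // l ≠ i} | V l ω ≤ V i ω}.ncard = a ∧
        {l : {l // l ≠ i} | U l ω ≤ x}.ncard ∈ T} =
      ∫⁻ v in B, ENNReal.ofReal (binomialProb a b v * poissonBinomial (successProb C a b x v) T)
        ∂((μ.restrict (U i ⁻¹' A)).map (V i)) := by
  classical
  have := hindep.isProbabilityMeasure
  have hZ (i : ι) : Measurable fun ω => (U i ω, V i ω) := (hU i).prodMk (hV i)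
  let S : Set (ℝ × ({l // l ≠ i} → ℝ × ℝ)) :=
    {p | p.1 ∈ B ∧ {l | (p.2 l).2 ≤ p.1}.ncard = a ∧ {l | (p.2 l).1 ≤ x}.ncard ∈ T}
  have hSV : MeasurableSet
      {p : ℝ × ({l // l ≠ i} → ℝ × ℝ) | {l | (p.2 l).2 ≤ p.1}.ncard ∈ ({a} : Set ℕ)} :=
    measurableSet_ncard_mem (A := fun l => {p : ℝ × ({l // l ≠ i} → ℝ × ℝ) | (p.2 l).2 ≤ p.1})
      (fun l => measurableSet_le (by fun_prop) measurable_fst) {a}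
  have hSU : MeasurableSet {p : ℝ × ({l // l ≠ i} → ℝ × ℝ) | {l | (p.2 l).1 ≤ x}.ncard ∈ T} :=
    measurableSet_ncard_mem (A := fun l => {p : ℝ × ({l // l ≠ i} → ℝ × ℝ) | (p.2 l).1 ≤ x})
      (fun l => measurableSet_le (by fun_prop) measurable_const) T
  have hS : MeasurableSet S := (measurable_fst hB).inter (hSV.inter hSU)
  have hcard : Fintype.card {l // l ≠ i} = a + b := by
    rw [Fintype.card_subtype_compl, Fintype.card_subtype_eq, hab, Nat.add_sub_cancel]
  have hdisint := measure_mem_and_prodMk_mem_eq_lintegral (X := U i) (Z := V i)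
    (Y := fun ω (l : {l // l ≠ i}) => (U l ω, V l ω)) (indepFun_subtype_ne hindep hZ i) (hV i)
    (measurable_pi_lambda _ fun l => hZ l) hA hS
  refine hdisint.trans ?_
  rw [← lintegral_indicator hB]
  have hac := (hlaw i).absolutelyContinuous_map_snd_restrict hC (hU i) (hV i) (U i ⁻¹' A)
  refine lintegral_congr_ae (hac.ae_le ?_)
  filter_upwards [ae_restrict_mem measurableSet_Ioo] with v hv
  by_cases hvB : v ∈ B
  · have hothers := measureReal_ncard_snd_le_eq_and_ncard_fst_le_mem hC
      (fun l : {l // l ≠ i} => hU l) (fun l => hV l)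
      (hindep.precomp Subtype.val_injective) (fun l => hlaw l) hx hv hcard T
    rw [indicator_of_mem hvB, ← hothers, ofReal_measureReal]
    simp [S, hvB]
  · simp [S, hvB]

theorem measure_snd_mem_and_ncard (hC : IsCopula C)
    (hU : ∀ i, Measurable (U i)) (hV : ∀ i, Measurable (V i))
    (hindep : iIndepFun (fun i ω => (U i ω, V i ω)) μ)
    (hlaw : ∀ i, FollowsCopula μ (U i) (V i) C) {x : ℝ} (hx : x ∈ Icc (0 : ℝ) 1) {a b : ℕ}
    (hab : Fintype.card ι = a + b + 1) (i : ι) {B : Set ℝ} (hB : MeasurableSet B) (T : Set ℕ) :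
    μ {ω | V i ω ∈ B ∧ {l : {l // l ≠ i} | V l ω ≤ V i ω}.ncard = a ∧
        {l : {l // l ≠ i} | U l ω ≤ x}.ncard ∈ T} =
      ∫⁻ v in B, ENNReal.ofReal (binomialProb a b v * poissonBinomial (successProb C a b x v) T)
        ∂(volume.restrict (Ioo 0 1)) := by
  have := hindep.isProbabilityMeasure
  have h := measure_fst_mem_and_snd_mem_and_ncard hC hU hV hindep hlaw hx hab i
    MeasurableSet.univ hB T
  simpa only [mem_univ, true_and, preimage_univ, Measure.restrict_univ,
    (hlaw i).map_snd hC (hU i) (hV i)] using h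

theorem measure_fst_le_and_snd_mem_and_ncard (hC : IsCopula C)
    (hU : ∀ i, Measurable (U i)) (hV : ∀ i, Measurable (V i))
    (hindep : iIndepFun (fun i ω => (U i ω, V i ω)) μ)
    (hlaw : ∀ i, FollowsCopula μ (U i) (V i) C) {x : ℝ} (hx : x ∈ Icc (0 : ℝ) 1) {a b : ℕ}
    (hab : Fintype.card ι = a + b + 1) (i : ι) {B : Set ℝ} (hB : MeasurableSet B) (T : Set ℕ) :
    μ {ω | U i ω ≤ x ∧ V i ω ∈ B ∧ {l : {l // l ≠ i} | V l ω ≤ V i ω}.ncard = a ∧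
        {l : {l // l ≠ i} | U l ω ≤ x}.ncard ∈ T} =
      ∫⁻ v in B, ENNReal.ofReal (binomialProb a b v *
          (deriv (C x) v * poissonBinomial (successProb C a b x v) T))
        ∂(volume.restrict (Ioo 0 1)) := by
  have := hindep.isProbabilityMeasure
  refine (measure_fst_mem_and_snd_mem_and_ncard hC hU hV hindep hlaw hx hab i
    measurableSet_Iic hB T).trans ?_
  rw [show U i ⁻¹' Iic x = {ω | U i ω ≤ x} from rfl,
    (hlaw i).map_snd_restrict_fst_le hC (hU i) (hV i) hx,
    setLIntegral_withDensity_eq_setLIntegral_mul_non_measurable _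
      (measurable_deriv (C x)).ennreal_ofReal _ hB (by simp)]
  refine lintegral_congr_ae (ae_restrict_of_ae ?_)
  filter_upwards [ae_restrict_mem measurableSet_Ioo] with v hv
  rw [Pi.mul_apply, ← ENNReal.ofReal_mul (hC.deriv_nonneg hx hv), mul_left_comm]

theorem measure_snd_mem_and_ncard_eq (hC : IsCopula C)
    (hU : ∀ i, Measurable (U i)) (hV : ∀ i, Measurable (V i))
    (hindep : iIndepFun (fun i ω => (U i ω, V i ω)) μ)
    (hlaw : ∀ i, FollowsCopula μ (U i) (V i) C) {a b : ℕ}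
    (hab : Fintype.card ι = a + b + 1) (i : ι) {B : Set ℝ} (hB : MeasurableSet B) :
    μ {ω | V i ω ∈ B ∧ {l : {l // l ≠ i} | V l ω ≤ V i ω}.ncard = a} =
      ∫⁻ v in B, ENNReal.ofReal (binomialProb a b v) ∂(volume.restrict (Ioo 0 1)) := by
  have h := measure_snd_mem_and_ncard hC hU hV hindep hlaw (x := 0) (by simp) hab i hB univ
  simpa only [mem_univ, and_true, poissonBinomial_univ, mul_one] using h

theorem measure_snd_mem_and_ncard_eq_inter_le_ncard (hC : IsCopula C)
    (hU : ∀ i, Measurable (U i)) (hV : ∀ i, Measurable (V i))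
    (hindep : iIndepFun (fun i ω => (U i ω, V i ω)) μ)
    (hlaw : ∀ i, FollowsCopula μ (U i) (V i) C) {x : ℝ} (hx : x ∈ Icc (0 : ℝ) 1) {a b : ℕ}
    (hab : Fintype.card ι = a + b + 1) (i : ι) {B : Set ℝ} (hB : MeasurableSet B) {m : ℕ}
    (hm : 1 ≤ m) :
    μ ({ω | V i ω ∈ B ∧ {l : {l // l ≠ i} | V l ω ≤ V i ω}.ncard = a} ∩
        {ω | m ≤ {l | U l ω ≤ x}.ncard}) =
      ∫⁻ v in B, ENNReal.ofReal (binomialProb a b v * orderStatCondCDF C a b m x v)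
        ∂(volume.restrict (Ioo 0 1)) := by
  let others (T : Set ℕ) : Set Ω := {ω | V i ω ∈ B ∧
    {l : {l // l ≠ i} | V l ω ≤ V i ω}.ncard = a ∧ {l : {l // l ≠ i} | U l ω ≤ x}.ncard ∈ T}
  have hsplit : {ω | V i ω ∈ B ∧ {l : {l // l ≠ i} | V l ω ≤ V i ω}.ncard = a} ∩
      {ω | m ≤ {l | U l ω ≤ x}.ncard} =
      others (Ici m) ∪ ({ω | U i ω ≤ x} ∩ others {m - 1}) := by
    ext ω
    simp only [others, mem_inter_iff, mem_union, mem_ofPred_eq, mem_Ici, mem_singleton_iff,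
      ncard_setOf_eq_ncard_subtype_ne_add (fun l => U l ω ≤ x) i]
    grind
  have hdisj : Disjoint (others (Ici m)) ({ω | U i ω ≤ x} ∩ others {m - 1}) := by
    rw [Set.disjoint_left]
    rintro ω ⟨-, -, hge⟩ ⟨-, -, -, heq⟩
    simp only [mem_Ici, mem_singleton_iff] at hge heq
    omega
  have hmeas : MeasurableSet ({ω | U i ω ≤ x} ∩ others {m - 1}) :=
    (measurableSet_le (hU i) measurable_const).inter ((hV i hB).inter
      ((measurableSet_ncard_mem (fun l : {l // l ≠ i} => measurableSet_le (hV l) (hV i)) {a}).inter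
        (measurableSet_ncard_mem
          (fun l : {l // l ≠ i} => measurableSet_le (hU l) measurable_const) {m - 1})))
  have hae : AEMeasurable (fun v => ENNReal.ofReal (binomialProb a b v *
      poissonBinomial (successProb C a b x v) (Ici m))) ((volume.restrict (Ioo 0 1)).restrict B) :=
    ((measurable_binomialProb a b).aemeasurable.mul
      (hC.aemeasurable_poissonBinomial_successProb hx a b _)).ennreal_ofReal.restrict
  have hcondCDF := ae_restrict_of_forall_mem (μ := volume) measurableSet_Ioo fun v hv =>
    hC.ofReal_binomialProb_mul_orderStatCondCDF hx hv a b m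
  rw [hsplit, measure_union hdisj hmeas,
    measure_snd_mem_and_ncard hC hU hV hindep hlaw hx hab i hB,
    lintegral_congr_ae (ae_restrict_of_ae hcondCDF), lintegral_add_left' hae]
  exact congr_arg _ (measure_fst_le_and_snd_mem_and_ncard hC hU hV hindep hlaw hx hab i hB _)

end JointLaw

section OrderStatisticsLaw

open Set

/-- The density of the `k`-th order statistic of `n` independent uniform variables on `(0,1)`, with
respect to Lebesgue measure on `(0,1)`. -/
noncomputable def orderStatDensity (n k : ℕ) (v : ℝ) : ENNReal :=
  n * ENNReal.ofReal (binomialProb (k - 1) (n - k) v)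

theorem measurable_orderStatDensity (n k : ℕ) : Measurable (orderStatDensity n k) :=
  (measurable_binomialProb _ _).ennreal_ofReal.const_mul _

theorem orderStatDensity_ne_zero {n k : ℕ} (hn : n ≠ 0) {v : ℝ} (hv : v ∈ Ioo (0 : ℝ) 1) :
    orderStatDensity n k v ≠ 0 :=
  mul_ne_zero (Nat.cast_ne_zero.2 hn) (ENNReal.ofReal_pos.2 (binomialProb_pos _ _ hv)).ne'

theorem orderStatDensity_ne_top (n k : ℕ) (v : ℝ) : orderStatDensity n k v ≠ ⊤ :=
  ENNReal.mul_ne_top (ENNReal.natCast_ne_top n) ENNReal.ofReal_ne_top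

variable {Ω : Type*} [MeasurableSpace Ω] {μ : Measure Ω} {C : ℝ → ℝ → ℝ} {n k m : ℕ}
  {U V : Fin n → Ω → ℝ}

theorem ae_injective_snd (hC : IsCopula C)
    (hU : ∀ i, Measurable (U i)) (hV : ∀ i, Measurable (V i))
    (hindep : iIndepFun (fun i ω => (U i ω, V i ω)) μ)
    (hlaw : ∀ i, FollowsCopula μ (U i) (V i) C) :
    ∀ᵐ ω ∂μ, Function.Injective fun i => V i ω := by
  have := hindep.isProbabilityMeasure
  have hnull (i : Fin n) : NullSingletonClass (μ.map (V i)) := by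
    rw [(hlaw i).map_snd hC (hU i) (hV i)]
    infer_instance
  exact ae_injective_of_iIndepFun (hindep.comp (fun _ => Prod.snd) fun _ => measurable_snd) hV

theorem map_orderStat_eq_withDensity (hC : IsCopula C)
    (hU : ∀ i, Measurable (U i)) (hV : ∀ i, Measurable (V i))
    (hindep : iIndepFun (fun i ω => (U i ω, V i ω)) μ)
    (hlaw : ∀ i, FollowsCopula μ (U i) (V i) C) (hk : 1 ≤ k ∧ k ≤ n) :
    μ.map (fun ω => orderStat (fun i => V i ω) k hk) =
      (volume.restrict (Ioo 0 1)).withDensity (orderStatDensity n k) := by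
  have hcard : Fintype.card (Fin n) = k - 1 + (n - k) + 1 := by
    rw [Fintype.card_fin]
    omega
  ext B hB
  have hsum := measure_orderStat_mem_inter_eq_sum hV (ae_injective_snd hC hU hV hindep hlaw) hk hB
    MeasurableSet.univ
  simp only [inter_univ, measure_snd_mem_and_ncard_eq hC hU hV hindep hlaw hcard _ hB,
    Finset.sum_const, Finset.card_univ, Fintype.card_fin, nsmul_eq_mul] at hsum
  rw [Measure.map_apply (measurable_orderStat hV hk) hB, withDensity_apply _ hB]
  refine hsum.trans ?_
  unfold orderStatDensity
  rw [lintegral_const_mul _ (measurable_binomialProb _ _).ennreal_ofReal]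

theorem measure_orderStat_mem_inter_orderStat_le (hC : IsCopula C)
    (hU : ∀ i, Measurable (U i)) (hV : ∀ i, Measurable (V i))
    (hindep : iIndepFun (fun i ω => (U i ω, V i ω)) μ)
    (hlaw : ∀ i, FollowsCopula μ (U i) (V i) C) {x : ℝ} (hx : x ∈ Icc (0 : ℝ) 1)
    (hk : 1 ≤ k ∧ k ≤ n) (hm : 1 ≤ m ∧ m ≤ n) {B : Set ℝ} (hB : MeasurableSet B) :
    μ ({ω | orderStat (fun i => V i ω) k hk ∈ B} ∩ {ω | orderStat (fun i => U i ω) m hm ≤ x}) =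
      ∫⁻ v in B, orderStatDensity n k v *
          ENNReal.ofReal (orderStatCondCDF C (k - 1) (n - k) m x v)
        ∂(volume.restrict (Ioo 0 1)) := by
  have hcard : Fintype.card (Fin n) = k - 1 + (n - k) + 1 := by
    rw [Fintype.card_fin]
    omega
  have hsum := measure_orderStat_mem_inter_eq_sum hV (ae_injective_snd hC hU hV hindep hlaw) hk hB
    (measurableSet_le (measurable_orderStat hU hm) (measurable_const (a := x)))
  simp only [orderStat_le_iff, Finset.sum_const, Finset.card_univ, Fintype.card_fin, nsmul_eq_mul,
    measure_snd_mem_and_ncard_eq_inter_le_ncard hC hU hV hindep hlaw hx hcard _ hB hm.1] at hsum ⊢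
  rw [hsum, ← lintegral_const_mul' _ _ (ENNReal.natCast_ne_top n)]
  refine lintegral_congr_ae (ae_restrict_of_ae ?_)
  filter_upwards [ae_restrict_mem measurableSet_Ioo] with v hv
  rw [orderStatDensity, ENNReal.ofReal_mul (binomialProb_pos _ _ hv).le, mul_assoc]

theorem ae_condDistrib_eq_of_forall_measure_eq {α β : Type*} [MeasurableSpace α]
    [MeasurableSpace β] [StandardBorelSpace β] [Nonempty β] [IsFiniteMeasure μ] {X : Ω → β}
    {Y : Ω → α} (hX : Measurable X) (hY : Measurable Y) {ρ : Measure α} [SigmaFinite ρ]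
    {d h : α → ENNReal} (hd : Measurable d) (hd0 : ∀ᵐ y ∂ρ, d y ≠ 0 ∧ d y ≠ ⊤)
    (hmap : μ.map Y = ρ.withDensity d) (hh : AEMeasurable h ρ) {s : Set β} (hs : MeasurableSet s)
    (hjoint : ∀ B, MeasurableSet B → μ (Y ⁻¹' B ∩ X ⁻¹' s) = ∫⁻ y in B, d y * h y ∂ρ) :
    ∀ᵐ y ∂ρ, condDistrib X Y μ y s = h y := by
  have hκ : Measurable fun y => condDistrib X Y μ y s := Kernel.measurable_coe _ hs
  have hae : (fun y => d y * condDistrib X Y μ y s) =ᵐ[ρ] fun y => d y * h y := by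
    refine ae_eq_of_forall_setLIntegral_eq_of_sigmaFinite₀ (hd.mul hκ).aemeasurable
      (hd.aemeasurable.mul hh) fun B hB _ => ?_
    rw [← hjoint B hB, ← setLIntegral_preimage_condDistrib hY hX.aemeasurable hs hB,
      ← setLIntegral_map hB hκ hY, hmap, setLIntegral_withDensity_eq_setLIntegral_mul _ hd hκ hB]
    rfl
  filter_upwards [hae, hd0] with y hy hdy using (ENNReal.mul_right_inj hdy.1 hdy.2).1 hy

theorem ae_condDistrib_orderStat_real_Iic [IsFiniteMeasure μ] (hC : IsCopula C)
    (hU : ∀ i, Measurable (U i)) (hV : ∀ i, Measurable (V i))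
    (hindep : iIndepFun (fun i ω => (U i ω, V i ω)) μ)
    (hlaw : ∀ i, FollowsCopula μ (U i) (V i) C) {x : ℝ} (hx : x ∈ Icc (0 : ℝ) 1)
    (hk : 1 ≤ k ∧ k ≤ n) (hm : 1 ≤ m ∧ m ≤ n) :
    ∀ᵐ y ∂(volume.restrict (Ioo 0 1)),
      (condDistrib (fun ω => orderStat (fun i => U i ω) m hm)
        (fun ω => orderStat (fun i => V i ω) k hk) μ y).real (Iic x) =
      orderStatCondCDF C (k - 1) (n - k) m x y := by
  have hd : ∀ᵐ v ∂(volume.restrict (Ioo 0 1)),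
      orderStatDensity n k v ≠ 0 ∧ orderStatDensity n k v ≠ ⊤ :=
    ae_restrict_of_forall_mem measurableSet_Ioo fun v hv =>
      ⟨orderStatDensity_ne_zero (by omega) hv, orderStatDensity_ne_top n k v⟩
  have hcond := ae_condDistrib_eq_of_forall_measure_eq (measurable_orderStat hU hm)
    (measurable_orderStat hV hk) (measurable_orderStatDensity n k) hd
    (map_orderStat_eq_withDensity hC hU hV hindep hlaw hk)
    (hC.aemeasurable_orderStatCondCDF hx (k - 1) (n - k) m).ennreal_ofReal
    (measurableSet_Iic (a := x)) fun B hB =>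
      measure_orderStat_mem_inter_orderStat_le hC hU hV hindep hlaw hx hk hm hB
  filter_upwards [hcond, ae_restrict_mem measurableSet_Ioo] with y hy hyI
  rw [measureReal_def, hy, ENNReal.toReal_ofReal (hC.orderStatCondCDF_nonneg hx hyI _ _ _)]

end OrderStatisticsLaw

section ConditionalSample

open Set

theorem countIn_eq_ncard {Ω : Type*} {a b : ℕ} (W₁ : Fin a → Ω → ℝ) (W₂ : Fin b → Ω → ℝ) (x : ℝ)
    (ω : Ω) : countIn W₁ W₂ x ω = {i | Sum.elim W₁ W₂ i ω ∈ Icc 0 x}.ncard := by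
  classical
  rw [ncard_eq_toFinset_card', toFinset_ofPred, Finset.card_filter, Fintype.sum_sum_type]
  simp only [countIn, indicator_apply, Sum.elim_inl, Sum.elim_inr]
  congr!

variable {C : ℝ → ℝ → ℝ} {a b : ℕ} {x y : ℝ}

theorem measureReal_Icc_zero_of_forall_real_Iic_eq {ρ : Measure ℝ} [IsFiniteMeasure ρ] {F : ℝ → ℝ}
    (hF : ∀ u ∈ Icc (0 : ℝ) 1, ρ.real (Iic u) = F u) (hF0 : F 0 = 0) (hx : x ∈ Icc (0 : ℝ) 1) :
    ρ.real (Icc 0 x) = F x := by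
  have hzero : ρ.real (Iic 0) = 0 := (hF 0 (by simp)).trans hF0
  have hIio : ρ.real (Iio 0) = 0 :=
    measureReal_mono_null Iio_subset_Iic_self hzero
  rw [← hF x hx, ← Iio_union_Icc_eq_Iic hx.1, measureReal_union _ measurableSet_Icc, hIio, zero_add]
  exact (Iio_disjoint_Ici le_rfl).mono_right Icc_subset_Ici_self

theorem IsConditionalSample.real_countIn_mem {Ω : Type*} [MeasurableSpace Ω] {ν : Measure Ω}
    {W₁ : Fin a → Ω → ℝ} {W₂ : Fin b → Ω → ℝ} (hC : IsCopula C)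
    (hW : IsConditionalSample ν C y W₁ W₂) (hx : x ∈ Icc (0 : ℝ) 1) (hy : y ∈ Icc (0 : ℝ) 1)
    (T : Set ℕ) :
    ν.real {ω | countIn W₁ W₂ x ω ∈ T} = poissonBinomial (successProb C a b x y) T := by
  have := hW.indep.isProbabilityMeasure
  have hm : ∀ i, Measurable (Sum.elim W₁ W₂ i) := by
    rintro (i | i)
    exacts [hW.measurable_fst i, hW.measurable_snd i]
  have hp : ∀ i, ν.real (Sum.elim W₁ W₂ i ⁻¹' Icc 0 x) = successProb C a b x y i := by
    intro i
    rw [← map_measureReal_apply (hm i) measurableSet_Icc]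
    rcases i with i | i
    · refine measureReal_Icc_zero_of_forall_real_Iic_eq (F := fun u => C u y / y) (fun u hu => ?_)
        (by simp [hC.zero_left y hy]) hx
      exact (map_measureReal_apply (hm _) measurableSet_Iic).trans (hW.cdf_fst i u hu)
    · refine measureReal_Icc_zero_of_forall_real_Iic_eq (F := fun u => (u - C u y) / (1 - y))
        (fun u hu => ?_) (by simp [hC.zero_left y hy]) hx
      exact (map_measureReal_apply (hm _) measurableSet_Iic).trans (hW.cdf_snd i u hu)
  have h := measureReal_forall_mem_and_ncard_mem (E := fun _ => univ) hW.indep hm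
    (fun _ => MeasurableSet.univ) (measurableSet_Icc (a := 0) (b := x))
    (fun i => by simpa using hp i) T
  simpa [countIn_eq_ncard] using h

variable {Ω : Type*} [MeasurableSpace Ω] {μ : Measure Ω} [IsProbabilityMeasure μ] {U V : Ω → ℝ}

theorem FollowsCopula.exists_isConditionalSample (hC : IsCopula C) (h : FollowsCopula μ U V C)
    (hU : Measurable U) (hV : Measurable V) (hy : y ∈ Ioo (0 : ℝ) 1) (a b : ℕ) :
    ∃ (Ω' : Type) (_ : MeasurableSpace Ω') (ν : Measure Ω') (W₁ : Fin a → Ω' → ℝ)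
      (W₂ : Fin b → Ω' → ℝ), IsProbabilityMeasure ν ∧ IsConditionalSample ν C y W₁ W₂ := by
  have hyI := Ioo_subset_Icc_self hy
  have hle : μ {ω | V ω ≤ y} ≠ 0 := fun h0 => hy.1.ne' <| by
    rw [← h.real_snd_le hC hU hV hyI, measureReal_def, h0, ENNReal.toReal_zero]
  have hgt : μ {ω | y < V ω} ≠ 0 := fun h0 => (sub_pos.2 hy.2).ne' <| by
    rw [← h.real_snd_gt hC hU hV hyI, measureReal_def, h0, ENNReal.toReal_zero]
  have := cond_isProbabilityMeasure hle
  have := cond_isProbabilityMeasure hgt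
  let ρ : Fin a ⊕ Fin b → Measure ℝ := Sum.elim (fun _ => (cond μ {ω | V ω ≤ y}).map U)
    (fun _ => (cond μ {ω | y < V ω}).map U)
  have hρ : ∀ i, IsProbabilityMeasure (ρ i) := by
    rintro (_ | _) <;> exact Measure.isProbabilityMeasure_map hU.aemeasurable
  have heval (i : Fin a ⊕ Fin b) (u : ℝ) :
      (Measure.pi ρ).real {w | w i ≤ u} = (ρ i).real (Iic u) :=
    (measurePreserving_eval ρ i).measureReal_preimage measurableSet_Iic.nullMeasurableSet
  refine ⟨Fin a ⊕ Fin b → ℝ, inferInstance, Measure.pi ρ, fun i w => w (Sum.inl i),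
    fun i w => w (Sum.inr i), inferInstance, fun i => measurable_pi_apply _,
    fun i => measurable_pi_apply _, ?_, fun i u hu => ?_, fun i u hu => ?_⟩
  · convert iIndepFun_pi (μ := ρ) (X := fun _ => id) (fun _ => aemeasurable_id) using 1
    ext i w
    rcases i with i | i <;> rfl
  · exact (heval _ u).trans ((map_measureReal_apply hU measurableSet_Iic).trans
      (h.cond_real_fst_le hC hU hV hu hyI).1)
  · exact (heval _ u).trans ((map_measureReal_apply hU measurableSet_Iic).trans
      (h.cond_real_fst_le hC hU hV hu hyI).2)

end ConditionalSample

section ExceptionalSet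

open Set

variable {C : ℝ → ℝ → ℝ}

theorem orderStatCondCDF_clampSquare {x y : ℝ} (hx : x ∈ Icc (0 : ℝ) 1) (hy : y ∈ Ioo (0 : ℝ) 1)
    (a b m : ℕ) : orderStatCondCDF (clampSquare C) a b m x y = orderStatCondCDF C a b m x y := by
  simp only [orderStatCondCDF, successProb, clampSquare_of_mem hx (Ioo_subset_Icc_self hy),
    (clampSquare_eventuallyEq hx hy).deriv_eq]

theorem measurable_orderStatCondCDF (hC : Continuous (Function.uncurry C)) (a b m : ℕ) :
    Measurable fun p : ℝ × ℝ => orderStatCondCDF C a b m p.1 p.2 :=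
  have hpb (T : Set ℕ) :=
    measurable_poissonBinomial_successProb measurable_fst measurable_snd hC.measurable a b T
  (hpb _).add ((measurable_deriv_with_param hC).mul (hpb _))

theorem measurable_kernel_real_Iic (κ : Kernel ℝ ℝ) [IsFiniteKernel κ] :
    Measurable fun p : ℝ × ℝ => (κ p.2).real (Iic p.1) :=
  (Kernel.measurable_kernel_prodMk_left (κ := κ.comap (Prod.snd : ℝ × ℝ → ℝ) measurable_snd)
    (t := {q | q.2 ≤ q.1.1})
    (measurableSet_le measurable_snd measurable_fst.fst)).ennreal_toReal

/-- The points `(x, y)` at which `∂C/∂y` exists and the formula for the conditional distribution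
function holds, with `κ` for the conditional law of `U_{m:n}` given `V_{k:n}`, `a = k - 1` and
`b = n - k`. -/
def regularPoints (C : ℝ → ℝ → ℝ) (κ : Kernel ℝ ℝ) (a b m : ℕ) : Set (ℝ × ℝ) :=
  {p | p.1 ∈ Icc 0 1 ∧ p.2 ∈ Ioo 0 1 ∧ DifferentiableAt ℝ (C p.1) p.2 ∧
    (κ p.2).real (Iic p.1) = orderStatCondCDF C a b m p.1 p.2}

theorem IsCopula.measurableSet_regularPoints (hC : IsCopula C) (κ : Kernel ℝ ℝ) [IsFiniteKernel κ]
    (a b m : ℕ) : MeasurableSet (regularPoints C κ a b m) := by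
  have hcont := hC.continuous_clampSquare
  have hclamp : regularPoints C κ a b m =
      (Icc 0 1 ×ˢ Ioo 0 1) ∩ ({p | DifferentiableAt ℝ (clampSquare C p.1) p.2} ∩
        {p | (κ p.2).real (Iic p.1) = orderStatCondCDF (clampSquare C) a b m p.1 p.2}) := by
    ext p
    simp only [regularPoints, mem_ofPred_eq, mem_inter_iff, mem_prod]
    rw [and_assoc]
    refine and_congr_right fun hx => and_congr_right fun hy => ?_
    rw [orderStatCondCDF_clampSquare hx hy, (clampSquare_eventuallyEq hx hy).differentiableAt_iff]
  rw [hclamp]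
  exact (measurableSet_Icc.prod measurableSet_Ioo).inter
    ((measurableSet_of_differentiableAt_with_param ℝ hcont).inter
      (measurableSet_eq_fun (measurable_kernel_real_Iic κ)
        (measurable_orderStatCondCDF hcont _ _ _)))

theorem ae_mem_restrict_prod_of_forall_ae {α β : Type*} [MeasurableSpace α] [MeasurableSpace β]
    {μ : Measure α} {ν : Measure β} [SFinite μ] [SFinite ν] {s : Set α} {t : Set β}
    {G : Set (α × β)} (hs : MeasurableSet s) (hG : MeasurableSet G)
    (h : ∀ x ∈ s, ∀ᵐ y ∂(ν.restrict t), (x, y) ∈ G) :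
    ∀ᵐ p ∂((μ.prod ν).restrict (s ×ˢ t)), p ∈ G := by
  rw [← Measure.prod_restrict, Measure.ae_prod_iff_ae_ae (p := (· ∈ G)) hG]
  exact ae_restrict_of_forall_mem hs h

variable {Ω : Type*} [MeasurableSpace Ω] {μ : Measure Ω} {n k m : ℕ} {U V : Fin n → Ω → ℝ}

theorem ae_mem_regularPoints [IsFiniteMeasure μ] (hC : IsCopula C)
    (hU : ∀ i, Measurable (U i)) (hV : ∀ i, Measurable (V i))
    (hindep : iIndepFun (fun i ω => (U i ω, V i ω)) μ)
    (hlaw : ∀ i, FollowsCopula μ (U i) (V i) C) (hk : 1 ≤ k ∧ k ≤ n) (hm : 1 ≤ m ∧ m ≤ n) {x : ℝ}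
    (hx : x ∈ Icc (0 : ℝ) 1) :
    ∀ᵐ y ∂(volume.restrict (Icc 0 1)), (x, y) ∈ regularPoints C
      (condDistrib (fun ω => orderStat (fun i => U i ω) m hm)
        (fun ω => orderStat (fun i => V i ω) k hk) μ) (k - 1) (n - k) m := by
  rw [Measure.restrict_congr_set Ioo_ae_eq_Icc.symm]
  filter_upwards [ae_condDistrib_orderStat_real_Iic hC hU hV hindep hlaw hx hk hm,
    (hlaw ⟨0, by omega⟩).ae_differentiableAt (hV _) hx, ae_restrict_mem measurableSet_Ioo]
    with y hcdf hdiff hy using ⟨hx, hy, hdiff, hcdf⟩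

end ExceptionalSet

theorem lemma2p2 {Ω : Type*} [MeasurableSpace Ω] (μ : Measure Ω) [IsProbabilityMeasure μ]
    (C : ℝ → ℝ → ℝ) (hC : IsCopula C) (n : ℕ) (U V : Fin n → Ω → ℝ)
    (hU : ∀ i, Measurable (U i)) (hV : ∀ i, Measurable (V i))
    (hindep : iIndepFun (fun i ω => (U i ω, V i ω)) μ)
    (hlaw : ∀ i, FollowsCopula μ (U i) (V i) C)
    (k m : ℕ) (hk : 1 ≤ k ∧ k ≤ n) (hm : 1 ≤ m ∧ m ≤ n) :
    -- the two distribution functions are the conditional ones of `U` given `V ≤ y` and `V > y`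
    (∀ y ∈ Set.Ioo (0 : ℝ) 1, ∀ i, ∀ u ∈ Set.Icc (0 : ℝ) 1,
      (cond μ {ω | V i ω ≤ y}).real {ω | U i ω ≤ u} = C u y / y ∧
      (cond μ {ω | y < V i ω}).real {ω | U i ω ≤ u} = (u - C u y) / (1 - y)) ∧
    -- the auxiliary random variables exist
    (∀ y ∈ Set.Ioo (0 : ℝ) 1, ∃ (Ω' : Type) (_ : MeasurableSpace Ω') (ν : Measure Ω')
      (W₁ : Fin (k - 1) → Ω' → ℝ) (W₂ : Fin (n - k) → Ω' → ℝ),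
      IsProbabilityMeasure ν ∧ IsConditionalSample ν C y W₁ W₂) ∧
    -- the conditional distribution function, at all points of a set `G` of full measure
    ∃ G : Set (ℝ × ℝ),
      (∀ x ∈ Set.Icc (0 : ℝ) 1, ∀ᵐ y ∂(volume.restrict (Set.Icc (0 : ℝ) 1)), (x, y) ∈ G) ∧
      (∀ᵐ p ∂(volume.restrict (Set.Icc (0 : ℝ) 1 ×ˢ Set.Icc (0 : ℝ) 1)), p ∈ G) ∧
      ∀ x y : ℝ, (x, y) ∈ G →
        DifferentiableAt ℝ (fun v => C x v) y ∧
        ∀ (Ω' : Type*) [MeasurableSpace Ω'] (ν : Measure Ω') [IsProbabilityMeasure ν]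
          (W₁ : Fin (k - 1) → Ω' → ℝ) (W₂ : Fin (n - k) → Ω' → ℝ),
          IsConditionalSample ν C y W₁ W₂ →
          (condDistrib (fun ω => orderStat (fun i => U i ω) m hm)
              (fun ω => orderStat (fun i => V i ω) k hk) μ y).real (Set.Iic x) =
            ν.real {ω | m ≤ countIn W₁ W₂ x ω} +
              deriv (fun v => C x v) y * ν.real {ω | countIn W₁ W₂ x ω = m - 1} := by
  have hG (x : ℝ) (hx : x ∈ Set.Icc (0 : ℝ) 1) :=
    ae_mem_regularPoints hC hU hV hindep hlaw hk hm hx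
  refine ⟨fun y hy i u hu => (hlaw i).cond_real_fst_le hC (hU i) (hV i) hu
    (Set.Ioo_subset_Icc_self hy), fun y hy => (hlaw ⟨0, by omega⟩).exists_isConditionalSample hC
    (hU _) (hV _) hy _ _, _, hG, ae_mem_restrict_prod_of_forall_ae measurableSet_Icc
    (hC.measurableSet_regularPoints _ _ _ _) hG, ?_⟩
  rintro x y ⟨hx, hy, hdiff, hcdf⟩
  refine ⟨hdiff, fun Ω' _ ν _ W₁ W₂ hW => ?_⟩
  have hcount := hW.real_countIn_mem hC hx (Set.Ioo_subset_Icc_self hy)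
  rw [hcdf, orderStatCondCDF, ← hcount, ← hcount]
  simp only [Set.mem_Ici, Set.mem_singleton_iff]
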